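/- An $L$-algebra is a set $X$ with a binary operation $(x,y)\mapsto x\cdot y$ and an element $1\in X$ such that, for all $x,y,z\in X$, $x\cdot x=x\cdot 1=1$, $1\cdot x=x$, $(x\cdot y)\cdot(x\cdot z)=(y\cdot x)\cdot(y\cdot z)$, and $x\cdot y=y\cdot x=1$ implies $x=y$; it is partially ordered by $x\le y:\Leftrightarrow x\cdot y=1$. A self-similar $L$-algebra is a monoid $A$ with a second operation $\cdot$ satisfying $a\cdot ba=b$, $ab\cdot c=a\cdot(b\cdot c)$ and $(a\cdot b)a=(b\cdot a)b$; it is an $L$-algebra in which $a\wedge b=(a\cdot b)a$ is the meet of $a$ and $b$. The self-similar closure $S(X)$ of an $L$-algebra $X$ is the self-similar $L$-algebra freely generated by the $L$-algebra $X$, and $X$ is called $\wedge$-closed if, for every finite set of elements of $X$, the meet of their images in $S(X)$ is again the image of an element of $X$. An ideal of $X$ is a subset $I\ni 1$ such that, for all $x,y\in X$: $x\in I$ and $x\cdot y\in I$ imply $y\in I$; and $x\in I$ implies $(x\cdot y)\cdot y\in I$, $y\cdot x\in I$ and $y\cdot(x\cdot y)\in I$. Let $\langle x\rangle$ be the ideal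 generated by $x$, and for ideals $I,J$ put $I\cdot J=\{x\in X\mid\langle x\rangle\cap I\subseteq J\}$. An ideal $P\neq X$ is prime if for every ideal $I$ either $I\subseteq P$ or $I\cdot P\subseteq P$. Let $\operatorname{Spec}X$ be the set of prime ideals of $X$, with the topology whose open sets are the sets $U_I=\{P\in\operatorname{Spec}X\mid I\not\subseteq P\}$ for ideals $I$ of $X$. Proposition. Let $X$ be a $\wedge$-closed $L$-algebra. Then $x\mapsto U_{\langle x\rangle}$ is a well-defined map from $X$ to the set of quasi-compact open subsets of $\operatorname{Spec}X$, and it is bijective if and only if $X$ is a Brouwerian semilattice, that is, if and only if any two elements $x,y\in X$ have a meet $x\wedge y$ in $X$ and $x\wedge y\le z\Leftrightarrow x\le y\cdot z$ holds for all $x,y,z\in X$. -/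

import Mathlib

/-- An `L`-algebra: a set with a binary operation `x ⇨ y` (written `x · y` in the literature) and a
logical unit `1`, satisfying the cycloid equation and antisymmetry. -/
class LAlgebra (X : Type*) extends HImp X, One X where
  himp_self' : ∀ x : X, x ⇨ x = 1
  himp_one' : ∀ x : X, x ⇨ 1 = 1
  one_himp' : ∀ x : X, 1 ⇨ x = x
  cycloid' : ∀ x y z : X, (x ⇨ y) ⇨ (x ⇨ z) = (y ⇨ x) ⇨ (y ⇨ z)
  antisymm' : ∀ x y : X, x ⇨ y = 1 → y ⇨ x = 1 → x = y

namespace LAlgebra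

/-- The partial order of an `L`-algebra: `x ≤ y` if and only if `x ⇨ y = 1`. -/
instance instPartialOrder (X : Type*) [LAlgebra X] : PartialOrder X where
  le x y := x ⇨ y = 1
  le_refl := himp_self'
  le_trans x y z hxy hyz := by
    have h := cycloid' x y z
    rw [hxy, hyz, one_himp', himp_one'] at h
    exact h
  le_antisymm := antisymm'

/-- An `L`-algebra `X` is a Brouwerian semilattice if any two elements have a greatest lower bound
`x ∧ y` (with respect to the order of `X`) and `x ∧ y ≤ z ↔ x ≤ y ⇨ z`, where `⇨` is the operation
of `X`. (The unit `1` is the greatest element of every `L`-algebra.) -/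
def IsBrouwerianSemilattice (X : Type*) [LAlgebra X] : Prop :=
  ∃ inf : X → X → X, (∀ x y, IsGLB {x, y} (inf x y)) ∧ ∀ x y z, inf x y ≤ z ↔ x ≤ y ⇨ z

end LAlgebra

/-- Self-similar `L`-algebras, as an equational class: a monoid with a second operation `a ⇨ b`
satisfying three equations. Equivalently, an `L`-algebra such that for each `y` the map `z ↦ y ⇨ z`
is a bijection from the down-set of `y` onto the whole algebra; the product `x * y` is then the
element `z ≤ y` with `y ⇨ z = x`. -/
class SelfSimilarLAlgebra (A : Type*) extends Monoid A, HImp A where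
  himp_mul_self' : ∀ a b : A, a ⇨ (b * a) = b
  mul_himp' : ∀ a b c : A, (a * b) ⇨ c = a ⇨ (b ⇨ c)
  himp_mul_comm' : ∀ a b : A, (a ⇨ b) * a = (b ⇨ a) * b

namespace SelfSimilarLAlgebra

/-- A self-similar `L`-algebra is an `L`-algebra. -/
instance instLAlgebra (A : Type*) [SelfSimilarLAlgebra A] : LAlgebra A where
  himp_self' a := by simpa using himp_mul_self' a 1
  one_himp' a := by simpa using himp_mul_self' 1 a
  himp_one' a := by
    have h1 : (1 : A) ⇨ a = a := by simpa using himp_mul_self' 1 a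
    have h2 : (a ⇨ 1) * a = a := by
      have h := himp_mul_comm' a 1
      rwa [h1, mul_one] at h
    have h3 := himp_mul_self' a (a ⇨ 1)
    have h4 : a ⇨ a = 1 := by simpa using himp_mul_self' a 1
    rw [h2, h4] at h3
    exact h3.symm
  cycloid' a b c := by rw [← mul_himp', ← mul_himp', himp_mul_comm']
  antisymm' a b hab hba := by
    have h := himp_mul_comm' a b
    rwa [hab, hba, one_mul, one_mul] at h

/-- The meet of two elements of a self-similar `L`-algebra. -/
def meet {A : Type*} [SelfSimilarLAlgebra A] (a b : A) : A := (a ⇨ b) * a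

/-- `meet a b` is the greatest lower bound of `a` and `b`. -/
theorem isGLB_meet {A : Type*} [SelfSimilarLAlgebra A] (a b : A) :
    IsGLB {a, b} (meet a b) := by
  have key : ∀ a b : A, meet a b ≤ a := fun a b => by
    change ((a ⇨ b) * a) ⇨ a = 1
    rw [mul_himp', LAlgebra.himp_self', LAlgebra.himp_one']
  refine ⟨?_, ?_⟩
  · rintro x (rfl | rfl)
    · exact key _ _
    · have h := key x a
      rwa [meet, himp_mul_comm'] at h
  · intro c hc
    have hca : c ⇨ a = 1 := hc (Set.mem_insert _ _)
    have hcb : c ⇨ b = 1 := hc (Set.mem_insert_of_mem _ rfl)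
    have e : c = (a ⇨ c) * a := by
      have h := himp_mul_comm' c a
      rwa [hca, one_mul] at h
    have h1 : (a ⇨ c) ⇨ (a ⇨ b) = 1 := by rw [← mul_himp', ← e, hcb]
    have h2 : (a ⇨ b) ⇨ (a ⇨ c) = meet a b ⇨ c := by rw [meet, mul_himp']
    change c ⇨ meet a b = 1
    have h3 : a ⇨ meet a b = a ⇨ b := himp_mul_self' _ _
    rw [e, mul_himp', h3, h1]

end SelfSimilarLAlgebra

namespace LAlgebra

/-- Terms in the operations of a self-similar `L`-algebra with constants from `X`. -/
inductive Term (X : Type*) : Type _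
  | of : X → Term X
  | one : Term X
  | mul : Term X → Term X → Term X
  | imp : Term X → Term X → Term X

/-- The congruence on terms generated by the equations of self-similar `L`-algebras and by the
operation of `X`. -/
inductive Term.Rel (X : Type*) [LAlgebra X] : Term X → Term X → Prop
  | refl (a) : Term.Rel X a a
  | symm {a b} : Term.Rel X a b → Term.Rel X b a
  | trans {a b c} : Term.Rel X a b → Term.Rel X b c → Term.Rel X a c
  | mul_congr {a a' b b'} : Term.Rel X a a' → Term.Rel X b b' → Term.Rel X (.mul a b) (.mul a' b')
  | imp_congr {a a' b b'} : Term.Rel X a a' → Term.Rel X b b' → Term.Rel X (.imp a b) (.imp a' b')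
  | mul_assoc (a b c) : Term.Rel X (.mul (.mul a b) c) (.mul a (.mul b c))
  | one_mul (a) : Term.Rel X (.mul .one a) a
  | mul_one (a) : Term.Rel X (.mul a .one) a
  | imp_mul_self (a b) : Term.Rel X (.imp a (.mul b a)) b
  | mul_imp (a b c) : Term.Rel X (.imp (.mul a b) c) (.imp a (.imp b c))
  | imp_mul_comm (a b) : Term.Rel X (.mul (.imp a b) a) (.mul (.imp b a) b)
  | of_imp (x y : X) : Term.Rel X (.of (x ⇨ y)) (.imp (.of x) (.of y))

/-- The setoid of the congruence `Term.Rel X`. -/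
def Term.setoid (X : Type*) [LAlgebra X] : Setoid (Term X) :=
  ⟨Term.Rel X, ⟨Term.Rel.refl, Term.Rel.symm, Term.Rel.trans⟩⟩

/-- The self-similar closure `S(X)` of an `L`-algebra `X`: the self-similar `L`-algebra freely
generated by the `L`-algebra `X`. -/
def SelfSimilarClosure (X : Type*) [LAlgebra X] : Type _ := Quotient (Term.setoid X)

namespace SelfSimilarClosure

/-- The canonical map from `X` to its self-similar closure. -/
def of {X : Type*} [LAlgebra X] (x : X) : SelfSimilarClosure X :=
  Quotient.mk (Term.setoid X) (.of x)

/-- The operations of `S(X)`. -/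
instance instSelfSimilar (X : Type*) [LAlgebra X] :
    SelfSimilarLAlgebra (SelfSimilarClosure X) where
  mul := Quotient.map₂ Term.mul fun _ _ h _ _ h' => Term.Rel.mul_congr h h'
  one := Quotient.mk (Term.setoid X) .one
  himp := Quotient.map₂ Term.imp fun _ _ h _ _ h' => Term.Rel.imp_congr h h'
  mul_assoc := by
    rintro ⟨a⟩ ⟨b⟩ ⟨c⟩
    exact Quotient.sound (Term.Rel.mul_assoc a b c)
  one_mul := by
    rintro ⟨a⟩
    exact Quotient.sound (Term.Rel.one_mul a)
  mul_one := by
    rintro ⟨a⟩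
    exact Quotient.sound (Term.Rel.mul_one a)
  himp_mul_self' := by
    rintro ⟨a⟩ ⟨b⟩
    exact Quotient.sound (Term.Rel.imp_mul_self a b)
  mul_himp' := by
    rintro ⟨a⟩ ⟨b⟩ ⟨c⟩
    exact Quotient.sound (Term.Rel.mul_imp a b c)
  himp_mul_comm' := by
    rintro ⟨a⟩ ⟨b⟩
    exact Quotient.sound (Term.Rel.imp_mul_comm a b)

end SelfSimilarClosure

/-- The `∧`-closure `C(X)`: all finite meets, in the self-similar closure `S(X)`, of elements
of `X`. -/
def meetClosure (X : Type*) [LAlgebra X] : Set (SelfSimilarClosure X) :=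
  {s | ∃ l : List X, s = (l.map SelfSimilarClosure.of).foldr SelfSimilarLAlgebra.meet 1}

/-- `X` is `∧`-closed if it coincides with its `∧`-closure, that is, if it is closed under finite
meets in its self-similar closure. -/
def IsMeetClosed (X : Type*) [LAlgebra X] : Prop :=
  meetClosure X = Set.range (SelfSimilarClosure.of : X → SelfSimilarClosure X)

/-- Ideals of an `L`-algebra. -/
@[ext]
structure LIdeal (X : Type*) [LAlgebra X] where
  carrier : Set X
  one_mem' : 1 ∈ carrier
  mp' : ∀ x y : X, x ∈ carrier → x ⇨ y ∈ carrier → y ∈ carrier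
  himp_himp_mem' : ∀ x y : X, x ∈ carrier → (x ⇨ y) ⇨ y ∈ carrier
  himp_mem' : ∀ x y : X, x ∈ carrier → y ⇨ x ∈ carrier
  himp_himp_mem'' : ∀ x y : X, x ∈ carrier → y ⇨ (x ⇨ y) ∈ carrier

namespace LIdeal

instance instSetLike (X : Type*) [LAlgebra X] : SetLike (LIdeal X) X where
  coe := carrier
  coe_injective _ _ h := LIdeal.ext h

/-- Ideals are ordered by inclusion. -/
instance instPartialOrder (X : Type*) [LAlgebra X] : PartialOrder (LIdeal X) :=
  PartialOrder.lift (fun I => (I : Set X)) SetLike.coe_injective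

/-- The intersection of a set of ideals. -/
instance instInfSet (X : Type*) [LAlgebra X] : InfSet (LIdeal X) where
  sInf S :=
    { carrier := {x | ∀ I ∈ S, x ∈ I}
      one_mem' := fun I _ => I.one_mem'
      mp' := fun x y hx hxy I hI => I.mp' x y (hx I hI) (hxy I hI)
      himp_himp_mem' := fun x y hx I hI => I.himp_himp_mem' x y (hx I hI)
      himp_mem' := fun x y hx I hI => I.himp_mem' x y (hx I hI)
      himp_himp_mem'' := fun x y hx I hI => I.himp_himp_mem'' x y (hx I hI) }

/-- The complete lattice of ideals, with intersections as infima. -/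
instance instCompleteLattice (X : Type*) [LAlgebra X] : CompleteLattice (LIdeal X) :=
  completeLatticeOfInf (LIdeal X) fun _ =>
    ⟨fun _ hI _ hx => hx _ hI, fun _ hJ _ hx _ hI => hJ hI hx⟩

/-- The ideal `⟨x⟩` generated by an element `x`. -/
def span {X : Type*} [LAlgebra X] (x : X) : LIdeal X := sInf {I | x ∈ I}

/-- The operation `I · J = {x | ⟨x⟩ ∩ I ⊆ J}` on ideals (as a subset of `X`). -/
def imp {X : Type*} [LAlgebra X] (I J : LIdeal X) : Set X :=
  {x | (span x : Set X) ∩ (I : Set X) ⊆ (J : Set X)}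

/-- A proper ideal `P` is prime if for every ideal `I`, either `I ⊆ P` or `I · P ⊆ P`. -/
def IsPrime {X : Type*} [LAlgebra X] (P : LIdeal X) : Prop :=
  (P : Set X) ≠ Set.univ ∧
    ∀ I : LIdeal X, (I : Set X) ⊆ (P : Set X) ∨ imp I P ⊆ (P : Set X)

end LIdeal

/-- The spectrum of an `L`-algebra: the set of its prime ideals. -/
structure Spec (X : Type*) [LAlgebra X] where
  ideal : LIdeal X
  isPrime : ideal.IsPrime

namespace Spec

/-- The set `U_I` of all prime ideals `P` with `I ⊄ P`. -/
def U {X : Type*} [LAlgebra X] (I : LIdeal X) : Set (Spec X) :=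
  {P | ¬ (I : Set X) ⊆ (P.ideal : Set X)}

/-- The topology of the spectrum: the open sets are the sets `U_I`, for ideals `I`. -/
instance instTopologicalSpace (X : Type*) [LAlgebra X] : TopologicalSpace (Spec X) where
  IsOpen s := ∃ I : LIdeal X, s = U I
  isOpen_univ := by
    refine ⟨⟨Set.univ, trivial, fun _ _ _ _ => trivial, fun _ _ _ => trivial, fun _ _ _ => trivial,
      fun _ _ _ => trivial⟩, ?_⟩
    refine (Set.eq_univ_of_forall fun P h => ?_).symm
    exact P.isPrime.1 (Set.eq_univ_of_univ_subset h)
  isOpen_inter := by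
    rintro _ _ ⟨I, rfl⟩ ⟨J, rfl⟩
    refine ⟨sInf {I, J}, Set.ext fun P => ⟨?_, fun h => ⟨fun hI => h ?_, fun hJ => h ?_⟩⟩⟩
    · rintro ⟨hI, hJ⟩ h
      rcases P.isPrime.2 I with h1 | h1
      · exact hI h1
      · refine hJ fun x hx => h1 ?_
        rintro y ⟨hy, hyI⟩
        refine h ?_
        rintro K (rfl | rfl)
        · exact hyI
        · exact hy K hx
    · exact fun x hx => hI (hx I (Or.inl rfl))
    · exact fun x hx => hJ (hx J (Or.inr rfl))
  isOpen_sUnion := by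
    intro S hS
    refine ⟨sSup {I | U I ∈ S}, Set.ext fun P => ⟨?_, fun h => ?_⟩⟩
    · rintro ⟨s, hs, hP⟩ h
      obtain ⟨I, rfl⟩ := hS s hs
      have h' : sSup {I | U I ∈ S} ≤ P.ideal := h
      have hI : I ≤ P.ideal := le_trans (le_sSup (show I ∈ {I | U I ∈ S} from hs)) h'
      exact hP hI
    · by_contra hcon
      refine h (show sSup {I | U I ∈ S} ≤ P.ideal from sSup_le fun I hI => ?_)
      by_contra hIP
      exact hcon ⟨U I, hI, hIP⟩

/-- The set of quasi-compact open subsets of the spectrum. -/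
def quasiCompactOpens (X : Type*) [LAlgebra X] : Set (Set (Spec X)) :=
  {V | IsOpen V ∧ IsCompact V}

end Spec

end LAlgebra

/-! Prime ideals separate elements from ideals (`exists_prime`: Zorn, plus distributivity of the
ideal lattice). Hence `U` embeds the order of ideals into that of open sets, and x ↦ U⟨x⟩ is
injective exactly when x ↦ ⟨x⟩ is. Each U⟨x⟩ is quasi-compact because generating an ideal is a
finitary process.

In a Brouwerian semilattice ⟨x⟩ is the up-set of x, which gives injectivity; a quasi-compact U_I is
covered by finitely many U⟨x⟩ with x ∈ I, and a common lower bound of these x in I generates I.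

Conversely, injectivity alone suffices. `∧`-closedness yields meets in X with y ⇨ (x ∧ y) = y ⇨ x.
If y ∈ ⟨x⟩, this puts x ∧ y into ⟨x⟩, so ⟨x ∧ y⟩ = ⟨x⟩ and x ≤ y. Thus ⟨x⟩ is again the up-set of x,
and the adjunction follows. Bringing meets down from S(X) to X requires X → S(X) to be injective,
which is proved in a model of S(X) by words. -/

namespace LAlgebra

section Basic

variable {X : Type*} [LAlgebra X]

theorem le_iff_himp_eq_one {x y : X} : x ≤ y ↔ x ⇨ y = 1 := Iff.rfl

theorem himp_le_himp_left {a b : X} (h : a ≤ b) (c : X) : c ⇨ a ≤ c ⇨ b := by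
  rw [le_iff_himp_eq_one] at h ⊢
  rw [cycloid', h, himp_one']

end Basic

/-! ### A model of the self-similar closure on words -/

namespace Word

variable {X : Type*} [LAlgebra X]

/-- The action of a word on a letter. -/
def act (w : List X) (x : X) : X := w.foldr (· ⇨ ·) x

/-- The action of a letter on a word. -/
def letterImp (x : X) : List X → List X
  | [] => []
  | c :: v => (act v x ⇨ c) :: letterImp x v

/-- The operation `w · v` on words. -/
def imp (w v : List X) : List X := w.foldr letterImp v

@[simp] theorem act_nil (x : X) : act [] x = x := rfl

@[simp] theorem act_cons (a : X) (w : List X) (x : X) : act (a :: w) x = a ⇨ act w x := rfl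

@[simp] theorem letterImp_nil (x : X) : letterImp x [] = [] := rfl

@[simp] theorem letterImp_cons (x c : X) (v : List X) :
    letterImp x (c :: v) = (act v x ⇨ c) :: letterImp x v := rfl

@[simp] theorem imp_nil_left (v : List X) : imp [] v = v := rfl

@[simp] theorem imp_cons_left (a : X) (w v : List X) :
    imp (a :: w) v = letterImp a (imp w v) := rfl

theorem act_append (u v : List X) (x : X) : act (u ++ v) x = act u (act v x) := by
  simp [act]

theorem imp_append_left (u v w : List X) : imp (u ++ v) w = imp u (imp v w) := by
  simp [imp]

@[simp] theorem imp_nil_right (w : List X) : imp w [] = [] := by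
  induction w with
  | nil => rfl
  | cons a w ih => simp [ih]

@[simp] theorem length_letterImp (x : X) (v : List X) : (letterImp x v).length = v.length := by
  induction v with
  | nil => rfl
  | cons c v ih => simp [ih]

@[simp] theorem length_imp (w v : List X) : (imp w v).length = v.length := by
  induction w with
  | nil => rfl
  | cons a w ih => simp [ih]

/-- One-letter case of the law a · bc = ((c · a) · b)(c-free part a · c) read with words as
products. The induction is on total length because the step exchanges the roles of `w` and `v`. -/
theorem imp_cons_right (w : List X) (c : X) (v : List X) :
    imp w (c :: v) = act (imp v w) c :: imp w v := by
  induction hn : w.length + v.length using Nat.strong_induction_on generalizing w c v with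
  | _ n ih =>
    cases w with
    | nil => simp
    | cons a w =>
      rw [List.length_cons] at hn
      rw [imp_cons_left, ih (w.length + v.length) (by omega) w c v rfl,
        ih (v.length + w.length) (by omega) v a w rfl]
      simp

theorem letterImp_append (x : X) (u v : List X) :
    letterImp x (u ++ v) = letterImp (act v x) u ++ letterImp x v := by
  induction u with
  | nil => simp
  | cons c u ih => simp [ih, act_append]

theorem imp_append_right (w u v : List X) :
    imp w (u ++ v) = imp (imp v w) u ++ imp w v := by
  induction w with
  | nil => simp
  | cons a w ih =>
    rw [imp_cons_left, ih, letterImp_append, imp_cons_right v a w]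
    simp

/-- A word of length at least two is split as a product, and the product laws reduce the identity to
triples of smaller total length; `imp` preserves the length of its second argument, so the measure
drops. Only three single letters remain, where this is the cycloid equation of `X`. -/
theorem imp_cycloid (a b c : List X) :
    imp (imp a b) (imp a c) = imp (imp b a) (imp b c) := by
  induction hn : a.length + b.length + c.length using Nat.strong_induction_on
    generalizing a b c with
  | _ n ih =>
    subst hn
    have split_third (c₁ c₂ : X) (c₃ a b : List X)
        (ih : ∀ m < a.length + b.length + (c₁ :: c₂ :: c₃).length, ∀ x y z : List X,
          x.length + y.length + z.length = m →
          imp (imp x y) (imp x z) = imp (imp y x) (imp y z)) :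
        imp (imp a b) (imp a (c₁ :: c₂ :: c₃)) = imp (imp b a) (imp b (c₁ :: c₂ :: c₃)) := by
      have e : c₁ :: c₂ :: c₃ = [c₁] ++ c₂ :: c₃ := rfl
      simp only [List.length_cons] at ih
      rw [e, imp_append_right a, imp_append_right b, imp_append_right (imp a b),
        imp_append_right (imp b a), ih _ (by simp only [List.length_cons]; omega) a (c₂ :: c₃) b rfl,
        ih _ (by simp only [List.length_cons]; omega) b (c₂ :: c₃) a rfl,
        ih _ (by simp only [List.length_cons]; omega) a b (c₂ :: c₃) rfl,
        ih _ (by simp only [length_imp, List.length_cons, List.length_nil]; omega)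
          (imp (c₂ :: c₃) a) (imp (c₂ :: c₃) b) [c₁] rfl]
    have split_first (a₁ a₂ : X) (a₃ b c : List X)
        (ih : ∀ m < (a₁ :: a₂ :: a₃).length + b.length + c.length, ∀ x y z : List X,
          x.length + y.length + z.length = m →
          imp (imp x y) (imp x z) = imp (imp y x) (imp y z)) :
        imp (imp (a₁ :: a₂ :: a₃) b) (imp (a₁ :: a₂ :: a₃) c) =
          imp (imp b (a₁ :: a₂ :: a₃)) (imp b c) := by
      have e : a₁ :: a₂ :: a₃ = [a₁] ++ a₂ :: a₃ := rfl
      simp only [List.length_cons] at ih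
      rw [e, imp_append_left, imp_append_left, imp_append_right b, imp_append_left,
        ih _ (by simp only [List.length_cons]; omega) b (a₂ :: a₃) c rfl,
        ih _ (by simp only [length_imp, List.length_cons, List.length_nil]; omega)
          [a₁] (imp (a₂ :: a₃) b) (imp (a₂ :: a₃) c) rfl]
    match a, b, c with
    | _, _, [] => simp
    | [], _, _ => simp
    | _, [], _ => simp
    | _, _, c₁ :: c₂ :: c₃ => exact split_third c₁ c₂ c₃ _ _ ih
    | a₁ :: a₂ :: a₃, _, _ => exact split_first a₁ a₂ a₃ _ _ ih
    | a, b₁ :: b₂ :: b₃, c =>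
      refine (split_first b₁ b₂ b₃ a c fun m hm x y z h => ih m (by omega) x y z h).symm
    | [x], [y], [z] => simp [cycloid' x y z]

/-- A word is trivial if all its letters are `1`. -/
def IsTrivial (w : List X) : Prop := ∀ x ∈ w, x = 1

theorem isTrivial_cons {c : X} {v : List X} : IsTrivial (c :: v) ↔ c = 1 ∧ IsTrivial v := by
  simp [IsTrivial]

theorem isTrivial_append {u v : List X} :
    IsTrivial (u ++ v) ↔ IsTrivial u ∧ IsTrivial v := by
  simp [IsTrivial, or_imp, forall_and]

theorem IsTrivial.act {w : List X} (h : IsTrivial w) (x : X) : act w x = x := by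
  induction w with
  | nil => rfl
  | cons a w ih =>
    rw [isTrivial_cons] at h
    rw [act_cons, ih h.2, h.1, one_himp']

theorem act_one (w : List X) : act w 1 = 1 := by
  induction w with
  | nil => rfl
  | cons a w ih => rw [act_cons, ih, himp_one']

theorem letterImp_one (v : List X) : letterImp 1 v = v := by
  induction v with
  | nil => rfl
  | cons c v ih => rw [letterImp_cons, ih, act_one, one_himp']

theorem IsTrivial.imp_left {w : List X} (h : IsTrivial w) (v : List X) : imp w v = v := by
  induction w with
  | nil => rfl
  | cons a w ih =>
    rw [isTrivial_cons] at h
    rw [imp_cons_left, ih h.2, h.1, letterImp_one]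

theorem IsTrivial.imp_right (w : List X) {v : List X} (h : IsTrivial v) :
    IsTrivial (imp w v) := by
  induction v with
  | nil => simpa using h
  | cons c v ih =>
    rw [isTrivial_cons] at h
    rw [imp_cons_right, isTrivial_cons, h.1, act_one]
    exact ⟨rfl, ih h.2⟩

theorem isTrivial_imp_self (w : List X) : IsTrivial (imp w w) := by
  induction w with
  | nil => simp [IsTrivial]
  | cons a w ih =>
    rw [imp_cons_left, imp_cons_right, ih.act, letterImp_cons, ih.act, himp_self',
      isTrivial_cons]
    exact ⟨rfl, ih.imp_right [a]⟩

/-- Two words are equivalent if each is below the other. -/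
def Equiv (u v : List X) : Prop := IsTrivial (imp u v) ∧ IsTrivial (imp v u)

theorem Equiv.refl (u : List X) : Equiv u u := ⟨isTrivial_imp_self u, isTrivial_imp_self u⟩

theorem Equiv.symm {u v : List X} (h : Equiv u v) : Equiv v u := ⟨h.2, h.1⟩

/-- The cycloid identity with both outer trivial words cancelled; this gives equality of words, not
just equivalence. -/
theorem Equiv.imp_left_eq {u v : List X} (h : Equiv u v) (w : List X) : imp u w = imp v w := by
  have h' := imp_cycloid u v w
  rwa [h.1.imp_left, h.2.imp_left] at h'

theorem Equiv.trans {u v w : List X} (h : Equiv u v) (h' : Equiv v w) : Equiv u w :=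
  ⟨by rw [h.imp_left_eq]; exact h'.1, by rw [← h'.imp_left_eq]; exact h.2⟩

theorem isTrivial_imp_imp (w : List X) {u v : List X} (h : IsTrivial (imp u v)) :
    IsTrivial (imp (imp w u) (imp w v)) := by
  rw [imp_cycloid]
  exact h.imp_right _

theorem Equiv.imp_congr {u u' v v' : List X} (h : Equiv u u') (h' : Equiv v v') :
    Equiv (imp u v) (imp u' v') := by
  rw [h.imp_left_eq]
  exact ⟨isTrivial_imp_imp _ h'.1, isTrivial_imp_imp _ h'.2⟩

theorem isTrivial_imp_append_right {u v w : List X} (h : IsTrivial (imp u v))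
    (hw : IsTrivial w) : IsTrivial (imp u (v ++ w)) := by
  rw [imp_append_right, hw.imp_left]
  exact isTrivial_append.2 ⟨h, hw.imp_right u⟩

theorem isTrivial_imp_append {u u' v v' : List X} (hu : IsTrivial (imp u u')) (hv : Equiv v v') :
    IsTrivial (imp (u ++ v) (u' ++ v')) := by
  rw [imp_append_left, imp_append_right, hv.2.imp_left]
  exact isTrivial_imp_append_right hu hv.1

theorem Equiv.append_congr {u u' v v' : List X} (h : Equiv u u') (h' : Equiv v v') :
    Equiv (u ++ v) (u' ++ v') :=
  ⟨isTrivial_imp_append h.1 h', isTrivial_imp_append h.2 h'.symm⟩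

theorem equiv_append_isTrivial (u : List X) {w : List X} (hw : IsTrivial w) :
    Equiv (u ++ w) u := by
  refine ⟨?_, isTrivial_imp_append_right (isTrivial_imp_self u) hw⟩
  rw [imp_append_left, hw.imp_left]
  exact isTrivial_imp_self u

theorem equiv_imp_append_self (a b : List X) : Equiv (imp a (b ++ a)) b := by
  rw [imp_append_right, (isTrivial_imp_self a).imp_left]
  exact equiv_append_isTrivial b (isTrivial_imp_self a)

theorem isTrivial_imp_meet (a b : List X) :
    IsTrivial (imp (imp a b ++ a) (imp b a ++ b)) := by
  rw [imp_append_left, imp_append_right a, imp_append_right (imp a b),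
    (isTrivial_imp_self (imp a b)).imp_left]
  exact isTrivial_append.2 ⟨isTrivial_imp_self _, isTrivial_imp_self _⟩

/-- The interpretation of terms by words. -/
def eval : Term X → List X
  | .of x => [x]
  | .one => []
  | .mul a b => eval a ++ eval b
  | .imp a b => imp (eval a) (eval b)

theorem equiv_eval {s t : Term X} (h : Term.Rel X s t) : Equiv (eval s) (eval t) := by
  induction h with
  | refl a => exact Equiv.refl _
  | symm _ ih => exact ih.symm
  | trans _ _ ih ih' => exact ih.trans ih'
  | mul_congr _ _ ih ih' => exact ih.append_congr ih'
  | imp_congr _ _ ih ih' => exact ih.imp_congr ih'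
  | mul_assoc a b c =>
    simp only [eval, List.append_assoc]
    exact Equiv.refl _
  | one_mul a => exact Equiv.refl _
  | mul_one a =>
    simp only [eval, List.append_nil]
    exact Equiv.refl _
  | imp_mul_self a b => exact equiv_imp_append_self _ _
  | mul_imp a b c =>
    simp only [eval, imp_append_left]
    exact Equiv.refl _
  | imp_mul_comm a b => exact ⟨isTrivial_imp_meet _ _, isTrivial_imp_meet _ _⟩
  | of_imp x y => exact Equiv.refl _

end Word

/-! ### Embedding of `X` into its self-similar closure, and descent of meets -/

namespace SelfSimilarClosure

variable {X : Type*} [LAlgebra X]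

theorem of_injective : Function.Injective (of : X → SelfSimilarClosure X) := by
  intro x y h
  have h' : Word.Equiv [x] [y] := Word.equiv_eval (Quotient.exact h)
  refine antisymm' x y ?_ ?_
  · simpa [Word.IsTrivial] using h'.1
  · simpa [Word.IsTrivial] using h'.2

theorem of_himp (x y : X) : of (x ⇨ y) = of x ⇨ of y :=
  Quotient.sound (Term.Rel.of_imp x y)

theorem of_one : of (1 : X) = 1 := by
  rw [← himp_self' (1 : X), of_himp]
  exact himp_self' _

theorem of_le_of {x y : X} : of x ≤ of y ↔ x ≤ y := by
  rw [le_iff_himp_eq_one (x := x), ← of_injective.eq_iff, of_himp, of_one]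
  rfl

end SelfSimilarClosure

open SelfSimilarClosure in
/-- In a `∧`-closed `L`-algebra any two elements have a meet, and `y ⇨ x = y ⇨ (x ∧ y)`. -/
theorem IsMeetClosed.exists_isGLB {X : Type*} [LAlgebra X] (hX : IsMeetClosed X) (x y : X) :
    ∃ z, IsGLB {x, y} z ∧ y ⇨ z = y ⇨ x := by
  -- In this order the meet is the product (y ⇨ x) * y, from which `himp_mul_self'` recovers y ⇨ x.
  have hmem : SelfSimilarLAlgebra.meet (of y) (of x) ∈ meetClosure X := by
    refine ⟨[y, x], ?_⟩
    have h : SelfSimilarLAlgebra.meet (of x) 1 = of x := by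
      rw [SelfSimilarLAlgebra.meet, show of x ⇨ 1 = 1 from himp_one' (of x), one_mul]
    simp [h]
  rw [hX] at hmem
  obtain ⟨z, hz⟩ := hmem
  have hglb := SelfSimilarLAlgebra.isGLB_meet (of y) (of x)
  rw [← hz] at hglb
  refine ⟨z, ⟨?_, fun c hc => ?_⟩, ?_⟩
  · rintro w (rfl | rfl)
    · exact of_le_of.1 (hglb.1 (Or.inr rfl))
    · exact of_le_of.1 (hglb.1 (Or.inl rfl))
  · refine of_le_of.1 (hglb.2 ?_)
    rintro w (rfl | rfl)
    · exact of_le_of.2 (hc (Or.inr rfl))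
    · exact of_le_of.2 (hc (Or.inl rfl))
  · apply of_injective
    rw [of_himp, of_himp, hz]
    exact SelfSimilarLAlgebra.himp_mul_self' _ _

/-! ### Ideals -/

namespace LIdeal

variable {X : Type*} [LAlgebra X]

theorem mem_of_himp_mem (I : LIdeal X) {x y : X} (hx : x ∈ I) (h : x ⇨ y ∈ I) : y ∈ I :=
  I.mp' x y hx h

theorem mem_of_le (I : LIdeal X) {x y : X} (hx : x ∈ I) (h : x ≤ y) : y ∈ I :=
  I.mp' x y hx (by rw [le_iff_himp_eq_one.1 h]; exact I.one_mem')

theorem mem_span_self (x : X) : x ∈ span x := fun _ h => h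

theorem span_le {x : X} {I : LIdeal X} : span x ≤ I ↔ x ∈ I :=
  ⟨fun h => h (mem_span_self x), fun h _ hy => hy I h⟩

theorem himp_mem_trans (I : LIdeal X) {a b c : X} (hab : a ⇨ b ∈ I) (hbc : b ⇨ c ∈ I) :
    a ⇨ c ∈ I := by
  refine I.mp' _ _ hab ?_
  rw [cycloid']
  exact I.himp_mem' _ _ hbc

theorem himp_himp_himp_mem (I : LIdeal X) {a b : X} (h : a ⇨ b ∈ I) (c : X) :
    (c ⇨ a) ⇨ (c ⇨ b) ∈ I := by
  rw [cycloid']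
  exact I.himp_mem' _ _ h

/-- Chain through (a ⇨ b) ⇨ (a ⇨ c), which the cycloid equation rewrites as (b ⇨ a) ⇨ (b ⇨ c). Hence
congruence modulo an ideal is compatible with `⇨` in the left argument too. -/
theorem himp_himp_himp_mem_left (I : LIdeal X) {a b : X} (hab : a ⇨ b ∈ I) (hba : b ⇨ a ∈ I)
    (c : X) : (a ⇨ c) ⇨ (b ⇨ c) ∈ I := by
  refine I.himp_mem_trans (I.himp_himp_mem'' (a ⇨ b) (a ⇨ c) hab) ?_
  rw [cycloid']
  exact I.himp_himp_mem' _ _ hba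

/-- Replacing i by (i ⇨ z) ⇨ z makes the witness congruent to z modulo J. So `join I J` consists of
the elements congruent modulo J to an element of I. -/
theorem exists_himp_mem_symm {I J : LIdeal X} {z : X} (h : ∃ i ∈ I, i ⇨ z ∈ J) :
    ∃ i ∈ I, i ⇨ z ∈ J ∧ z ⇨ i ∈ J := by
  obtain ⟨i, hi, hz⟩ := h
  exact ⟨_, I.himp_himp_mem' i z hi, J.himp_himp_mem' _ z hz, J.himp_himp_mem'' _ z hz⟩

/-- The join of two ideals. -/
def join (I J : LIdeal X) : LIdeal X where
  carrier := {z | ∃ i ∈ I, i ⇨ z ∈ J}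
  one_mem' := ⟨1, I.one_mem', by rw [himp_self']; exact J.one_mem'⟩
  mp' := by
    intro x y hx hxy
    obtain ⟨i, hi, hix, hxi⟩ := exists_himp_mem_symm hx
    obtain ⟨i', hi', h'⟩ := hxy
    -- Exchange x for the congruent i. The resulting j lies in J and implies i ⇨ y modulo I, so j ⇨
    -- y ∈ I will be the witness for y.
    have hj : i' ⇨ (i ⇨ y) ∈ J :=
      J.himp_mem_trans h' (J.himp_himp_himp_mem_left hxi hix y)
    set j := i' ⇨ (i ⇨ y)
    have h1 : j ⇨ (i ⇨ y) ∈ I := I.himp_himp_mem' i' _ hi'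
    have h2 : (i ⇨ j) ⇨ (i ⇨ y) ∈ I := I.himp_mem_trans (I.himp_himp_mem' i j hi) h1
    rw [cycloid'] at h2
    exact ⟨j ⇨ y, I.mp' _ _ (I.himp_mem' i j hi) h2, J.himp_himp_mem' j y hj⟩
  himp_himp_mem' := by
    intro x y hx
    obtain ⟨i, hi, hix, hxi⟩ := exists_himp_mem_symm hx
    exact ⟨_, I.himp_himp_mem' i y hi, J.himp_himp_himp_mem_left
      (J.himp_himp_himp_mem_left hix hxi y) (J.himp_himp_himp_mem_left hxi hix y) y⟩
  himp_mem' := by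
    rintro x y ⟨i, hi, hix⟩
    exact ⟨_, I.himp_mem' i y hi, J.himp_himp_himp_mem hix y⟩
  himp_himp_mem'' := by
    intro x y hx
    obtain ⟨i, hi, hix, hxi⟩ := exists_himp_mem_symm hx
    exact ⟨_, I.himp_himp_mem'' i y hi,
      J.himp_himp_himp_mem (J.himp_himp_himp_mem_left hix hxi y) y⟩

theorem le_join_left (I J : LIdeal X) : I ≤ join I J := fun x hx =>
  ⟨x, hx, by rw [himp_self']; exact J.one_mem'⟩

theorem le_join_right (I J : LIdeal X) : J ≤ join I J := fun x hx =>
  ⟨1, I.one_mem', by rw [one_himp']; exact hx⟩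

/-- Distributivity of the lattice of ideals. -/
theorem exists_mem_mem_himp_mem {I J P : LIdeal X} {z : X} (hI : z ∈ join I P)
    (hJ : z ∈ join J P) : ∃ m, m ∈ I ∧ m ∈ J ∧ m ⇨ z ∈ P := by
  obtain ⟨k, hk, hkz, -⟩ := exists_himp_mem_symm hI
  obtain ⟨l, hl, hlz, hzl⟩ := exists_himp_mem_symm hJ
  have hkl : k ⇨ l ∈ P := P.himp_mem_trans hkz hzl
  -- A substitute for the join of k and l: it lies in I because k does, in J because l does, and it
  -- implies l modulo P since k ⇨ l ∈ P.
  exact ⟨(k ⇨ l) ⇨ l, I.himp_himp_mem' k l hk, J.himp_mem' _ _ hl,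
    P.himp_mem_trans (P.himp_himp_mem' _ l hkl) hlz⟩

/-- The union of a nonempty chain of ideals. -/
def chainUnion (c : Set (LIdeal X)) (hc : IsChain (· ≤ ·) c) (hne : c.Nonempty) : LIdeal X where
  carrier := {x | ∃ I ∈ c, x ∈ I}
  one_mem' := hne.imp fun I hI => ⟨hI, I.one_mem'⟩
  mp' := by
    rintro x y ⟨I, hI, hx⟩ ⟨J, hJ, hxy⟩
    rcases hc.total hI hJ with h | h
    · exact ⟨J, hJ, J.mp' x y (h hx) hxy⟩
    · exact ⟨I, hI, I.mp' x y hx (h hxy)⟩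
  himp_himp_mem' := fun x y ⟨I, hI, hx⟩ => ⟨I, hI, I.himp_himp_mem' x y hx⟩
  himp_mem' := fun x y ⟨I, hI, hx⟩ => ⟨I, hI, I.himp_mem' x y hx⟩
  himp_himp_mem'' := fun x y ⟨I, hI, hx⟩ => ⟨I, hI, I.himp_himp_mem'' x y hx⟩

/-- Prime ideals separate elements from ideals. -/
theorem exists_prime (I : LIdeal X) {x : X} (hx : x ∉ I) :
    ∃ P : Spec X, I ≤ P.ideal ∧ x ∉ P.ideal := by
  obtain ⟨P, hIP, hmax⟩ := zorn_le_nonempty₀ {J : LIdeal X | x ∉ J}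
    (fun c hcs hc J hJ => ⟨chainUnion c hc ⟨J, hJ⟩, fun ⟨K, hK, hxK⟩ => hcs hK hxK,
      fun K hK y hy => ⟨K, hK, hy⟩⟩) I hx
  have hxP : x ∉ P := hmax.prop
  have hjoin : ∀ J : LIdeal X, ¬ J ≤ P → x ∈ join J P := fun J hJ => by
    by_contra h
    exact hJ ((le_join_left J P).trans (hmax.le_of_ge h (le_join_right J P)))
  refine ⟨⟨P, fun h => hxP (h.symm ▸ Set.mem_univ x : x ∈ (P : Set X)), fun J => ?_⟩, hIP, hxP⟩
  refine or_iff_not_imp_left.2 fun hJ y hy => ?_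
  by_contra hyP
  -- By maximality x lies in both joins with P; distributivity then gives m ∈ ⟨y⟩ ∩ J ⊆ P with m ⇨ x
  -- ∈ P, forcing x ∈ P.
  obtain ⟨m, hm, hmJ, hmx⟩ := exists_mem_mem_himp_mem
    (hjoin (span y) fun h => hyP (span_le.1 h)) (hjoin J hJ)
  exact hxP (P.mem_of_himp_mem (hy ⟨hm, hmJ⟩) hmx)

end LIdeal

/-! ### Open sets of the spectrum and quasi-compactness -/

namespace Spec

open LIdeal

variable {X : Type*} [LAlgebra X]

theorem mem_U {I : LIdeal X} {P : Spec X} : P ∈ U I ↔ ¬ I ≤ P.ideal := Iff.rfl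

theorem U_subset_U {I J : LIdeal X} : U I ⊆ U J ↔ I ≤ J := by
  refine ⟨fun h x hx => ?_, fun h P hP hJ => hP (h.trans hJ : I ≤ P.ideal)⟩
  by_contra hxJ
  obtain ⟨P, hJP, hxP⟩ := J.exists_prime hxJ
  exact h (show P ∈ U I from fun hI => hxP (hI hx)) hJP

theorem U_injective : Function.Injective (U : LIdeal X → Set (Spec X)) := fun _ _ h =>
  le_antisymm (U_subset_U.1 h.subset) (U_subset_U.1 h.superset)

theorem isOpen_U (I : LIdeal X) : IsOpen (U I) := ⟨I, rfl⟩

theorem isCompact_U_span (x : X) : IsCompact (U (span x)) := by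
  refine isCompact_of_finite_subcover fun {ι} V hV hcover => ?_
  choose I hI using hV
  -- The supremum of the `I i`, presented so that membership directly supplies a finite subfamily.
  let M : LIdeal X :=
    { carrier := {y | ∃ t : Finset ι, ∀ J : LIdeal X, (∀ i ∈ t, I i ≤ J) → y ∈ J}
      one_mem' := ⟨∅, fun J _ => J.one_mem'⟩
      mp' := by
        classical
        rintro a b ⟨s, hs⟩ ⟨t, ht⟩
        exact ⟨s ∪ t, fun J hJ => J.mp' a b
          (hs J fun i hi => hJ i (Finset.mem_union_left _ hi))
          (ht J fun i hi => hJ i (Finset.mem_union_right _ hi))⟩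
      himp_himp_mem' := fun a b ⟨t, ht⟩ => ⟨t, fun J hJ => J.himp_himp_mem' a b (ht J hJ)⟩
      himp_mem' := fun a b ⟨t, ht⟩ => ⟨t, fun J hJ => J.himp_mem' a b (ht J hJ)⟩
      himp_himp_mem'' := fun a b ⟨t, ht⟩ => ⟨t, fun J hJ => J.himp_himp_mem'' a b (ht J hJ)⟩ }
  have hxM : x ∈ M := by
    by_contra hx
    obtain ⟨P, hMP, hxP⟩ := M.exists_prime hx
    obtain ⟨i, hi⟩ := Set.mem_iUnion.1
      (hcover (show P ∈ U (span x) from fun h => hxP (h (mem_span_self x))))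
    rw [hI i] at hi
    exact hi fun y hy => hMP ⟨{i}, fun J hJ => hJ i (Finset.mem_singleton_self i) hy⟩
  obtain ⟨t, ht⟩ := hxM
  refine ⟨t, fun P hP => ?_⟩
  by_contra hcon
  simp only [Set.mem_iUnion, not_exists] at hcon
  refine hP (span_le.2 (ht P.ideal fun i hi => ?_))
  have h := hcon i hi
  rw [hI i, mem_U, not_not] at h
  exact h

end Spec

/-! ### From Brouwerian semilattices to bijectivity, and back -/

namespace IsBrouwerianSemilattice

open LIdeal Spec

variable {X : Type*} [LAlgebra X]

theorem span_eq_Ici (h : IsBrouwerianSemilattice X) (x y : X) : y ∈ span x ↔ x ≤ y := by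
  refine ⟨fun hy => ?_, fun hxy => (span x).mem_of_le (mem_span_self x) hxy⟩
  obtain ⟨inf, hinf, hadj⟩ := h
  have inf_le_left : ∀ a b, inf a b ≤ a := fun a b => (hinf a b).1 (Or.inl rfl)
  have inf_le_right : ∀ a b, inf a b ≤ b := fun a b => (hinf a b).1 (Or.inr rfl)
  have le_inf : ∀ {a b c}, c ≤ a → c ≤ b → c ≤ inf a b := fun {a b c} ha hb =>
    (hinf a b).2 (by rintro w (rfl | rfl) <;> assumption)
  have mp : ∀ {a b c : X}, c ≤ a → c ≤ a ⇨ b → c ≤ b := fun {a b c} ha hb =>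
    (le_inf le_rfl ha).trans ((hadj c a b).2 hb)
  let I : LIdeal X :=
    { carrier := Set.Ici x
      one_mem' := himp_one' x
      mp' := fun a b ha hab => mp ha hab
      himp_himp_mem' := fun a b (ha : x ≤ a) => ha.trans <| (hadj _ _ _).1 <|
        mp (inf_le_left _ _) (inf_le_right _ _)
      himp_mem' := fun a b (ha : x ≤ a) => ha.trans <| (hadj _ _ _).1 (inf_le_left _ _)
      himp_himp_mem'' := fun a b _ => (hadj _ _ _).1 <|
        (inf_le_right _ _).trans <| (hadj _ _ _).1 (inf_le_left _ _) }
  exact hy I (le_refl x)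

theorem span_injective (h : IsBrouwerianSemilattice X) :
    Function.Injective (span : X → LIdeal X) := fun x y hxy =>
  le_antisymm ((h.span_eq_Ici x y).1 (hxy ▸ mem_span_self y))
    ((h.span_eq_Ici y x).1 (hxy ▸ mem_span_self x))

/-- Ideals are closed under meets: m ≤ a ⇨ (m ∧ a), so m, a ∈ I give m ∧ a ∈ I. -/
theorem exists_lowerBound_mem (h : IsBrouwerianSemilattice X) (I : LIdeal X) (t : Finset X)
    (ht : ∀ x ∈ t, x ∈ I) : ∃ m ∈ I, ∀ x ∈ t, m ≤ x := by
  classical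
  obtain ⟨inf, hinf, hadj⟩ := h
  induction t using Finset.induction_on with
  | empty => exact ⟨1, I.one_mem', by simp⟩
  | insert a s _ ih =>
    obtain ⟨m, hm, hms⟩ := ih fun x hx => ht x (Finset.mem_insert_of_mem hx)
    have ha : a ∈ I := ht a (Finset.mem_insert_self a s)
    refine ⟨inf m a, I.mem_of_himp_mem ha (I.mem_of_le hm ((hadj m a _).1 le_rfl)), ?_⟩
    intro x hx
    rcases Finset.mem_insert.1 hx with rfl | hx
    · exact (hinf _ _).1 (Or.inr rfl)
    · exact le_trans ((hinf _ _).1 (Or.inl rfl)) (hms x hx)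

theorem exists_U_span_eq (h : IsBrouwerianSemilattice X) {I : LIdeal X}
    (hI : IsCompact (U I)) : ∃ m, U (span m) = U I := by
  obtain ⟨t, ht⟩ := hI.elim_finite_subcover (fun x : I => U (span (x : X)))
    (fun x => isOpen_U _) fun P hP => by
      obtain ⟨x, hx, hxP⟩ := Set.not_subset.1 hP
      exact Set.mem_iUnion.2 ⟨⟨x, hx⟩, fun hle => hxP (hle (mem_span_self x))⟩
  classical
  obtain ⟨m, hm, hmt⟩ := h.exists_lowerBound_mem I (t.image Subtype.val)
    (by simp +contextual)
  refine ⟨m, Set.Subset.antisymm (U_subset_U.2 (span_le.2 hm)) (ht.trans ?_)⟩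
  refine Set.iUnion₂_subset fun x hx => U_subset_U.2 (span_le.2 ?_)
  exact (span m).mem_of_le (mem_span_self m) (hmt x (Finset.mem_image_of_mem _ hx))

end IsBrouwerianSemilattice

/-- A `∧`-closed `L`-algebra is a Brouwerian semilattice if its elements are determined by the
ideals they generate. -/
theorem IsMeetClosed.isBrouwerianSemilattice {X : Type*} [LAlgebra X] (hX : IsMeetClosed X)
    (hinj : Function.Injective (LIdeal.span : X → LIdeal X)) : IsBrouwerianSemilattice X := by
  choose inf hinf hhimp using hX.exists_isGLB
  have inf_le_left : ∀ a b, inf a b ≤ a := fun a b => (hinf a b).1 (Or.inl rfl)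
  have inf_le_right : ∀ a b, inf a b ≤ b := fun a b => (hinf a b).1 (Or.inr rfl)
  -- The only use of injectivity: x and x ∧ y generate the same ideal.
  have le_of_mem : ∀ {x y : X}, y ∈ LIdeal.span x → x ≤ y := fun {x y} hy => by
    have hmem : inf x y ∈ LIdeal.span x := by
      refine (LIdeal.span x).mem_of_himp_mem hy ?_
      rw [hhimp]
      exact (LIdeal.span x).himp_mem' _ _ (LIdeal.mem_span_self x)
    have heq : inf x y = x := hinj <| le_antisymm (LIdeal.span_le.2 hmem) <|
      LIdeal.span_le.2 ((LIdeal.span _).mem_of_le (LIdeal.mem_span_self _) (inf_le_left x y))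
    exact heq ▸ inf_le_right x y
  refine ⟨inf, hinf, fun x y z => ⟨fun h => ?_, fun h => ?_⟩⟩
  · refine le_trans (le_of_mem ((LIdeal.span x).himp_mem' x y (LIdeal.mem_span_self x))) ?_
    rw [← hhimp]
    exact himp_le_himp_left h y
  -- Modus ponens inside ⟨x ∧ y⟩: it contains y and y ⇨ z, hence z.
  · have hm := LIdeal.mem_span_self (inf x y)
    exact le_of_mem <| (LIdeal.span (inf x y)).mem_of_himp_mem
      (LIdeal.mem_of_le _ hm (inf_le_right x y))
      (LIdeal.mem_of_le _ hm ((inf_le_left x y).trans h))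

end LAlgebra

theorem proposition9 {X : Type*} [LAlgebra X] (hX : LAlgebra.IsMeetClosed X) :
    Set.MapsTo (fun x : X => LAlgebra.Spec.U (LAlgebra.LIdeal.span x)) Set.univ
        (LAlgebra.Spec.quasiCompactOpens X) ∧
      (Set.BijOn (fun x : X => LAlgebra.Spec.U (LAlgebra.LIdeal.span x)) Set.univ
          (LAlgebra.Spec.quasiCompactOpens X) ↔
        LAlgebra.IsBrouwerianSemilattice X) := by
  have hmaps : Set.MapsTo (fun x : X => LAlgebra.Spec.U (LAlgebra.LIdeal.span x)) Set.univ
      (LAlgebra.Spec.quasiCompactOpens X) := fun x _ =>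
    ⟨LAlgebra.Spec.isOpen_U _, LAlgebra.Spec.isCompact_U_span x⟩
  refine ⟨hmaps, fun h => hX.isBrouwerianSemilattice fun x y hxy => ?_, fun h => ⟨hmaps, ?_, ?_⟩⟩
  · exact h.injOn (Set.mem_univ x) (Set.mem_univ y) (congrArg LAlgebra.Spec.U hxy)
  · exact (LAlgebra.Spec.U_injective.comp h.span_injective).injOn
  · rintro V ⟨⟨I, rfl⟩, hV⟩
    obtain ⟨m, hm⟩ := h.exists_U_span_eq hV
    exact ⟨m, Set.mem_univ m, hm⟩
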